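/- Let $X$ be a discrete torsion Abelian group, written additively, that contains no elements of order $2$ and whose $p$-component (the subgroup of all elements whose order is a power of $p$) is cyclic for every prime $p$. Let $\alpha$ be an automorphism of $X$ and let $I$ be the identity automorphism. Let $\xi_1$ and $\xi_2$ be independent random variables with values in $X$ and distributions $\mu_1$ and $\mu_2$. Assume that the conditional distribution of $L_2=\xi_1+\alpha\xi_2$ given $L_1=\xi_1+\xi_2$ is symmetric, i.e. for almost every value of $L_1$ this conditional distribution is invariant under $x\mapsto -x$. Then there are a subgroup $G$ of $X$ and a probability distribution $\lambda$ on $X$ supported in $G$ such that: (i) $\mu_1$ and $\mu_2$ are shifts of $\lambda$, i.e. $\mu_j=E_{x_j}*\lambda$ for some $x_j\in X$, $j=1,2$, where $E_x$ is the degenerate distribution at $x$ and $*$ is convolution; (ii) $G$ is the smallest subgroup of $X$ containing the support of $\lambda$; (iii) the subgroup $(I+\alpha)(G)=\{g+\alpha g: g\in G\}$ is finite; (iv) the Haar distribution $m_{(I+\alpha)(G)}$ (the normalized Haar measure of $(I+\alpha)(G)$, regarded as a distribution on $X$) is a factor of $\lambda$, i.e. $\lambda=m_{(I+\alpha)(G)}*\nu$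 for some probability distribution $\nu$ on $X$; (v) if $\eta_1$ and $\eta_2$ are independent identically distributed random variables with values in $X$ and distribution $\lambda$, then the conditional distribution of $M_2=\eta_1+\alpha\eta_2$ given $M_1=\eta_1+\eta_2$ is symmetric. -/

import Mathlib

open MeasureTheory ProbabilityTheory

/-- The conditional distribution of `L₂` given `L₁` is symmetric: there is a (regular) conditional
distribution `κ` of `L₂` given `L₁` such that for almost every value `x` of `L₁` the probability
distribution `κ x` is invariant under `t ↦ -t`. -/
def CondDistribIsSymmetric {Ω X : Type*} [MeasurableSpace Ω] [MeasurableSpace X] [Neg X]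
    (L₂ L₁ : Ω → X) (P : Measure Ω) : Prop :=
  ∃ κ : Kernel X X, IsMarkovKernel κ ∧ HasCondDistrib L₂ L₁ κ P ∧
    ∀ᵐ x ∂(P.map L₁), (κ x).map (fun t : X => -t) = κ x

/-- `μ` is a shift (translate) of `lam`: `μ = E_x * lam` for some `x`, where `E_x` is the
degenerate distribution at `x`. -/
def IsShiftOf {X : Type*} [MeasurableSpace X] [AddMonoid X] (μ lam : Measure X) : Prop :=
  ∃ x : X, μ = (Measure.dirac x).conv lam

/-- The distribution `m` is a factor of `lam`: `lam = m * ν` for some probability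
distribution `ν`. -/
def IsFactorOf {X : Type*} [MeasurableSpace X] [AddMonoid X] (m lam : Measure X) : Prop :=
  ∃ ν : Measure X, IsProbabilityMeasure ν ∧ lam = m.conv ν

/-- The Haar distribution `m_K` of a compact subgroup `K` of `X`, as a distribution on `X`:
the Haar measure of `K` of total mass `1`, pushed forward along the inclusion. -/
noncomputable def haarDistribution {X : Type*} [AddCommGroup X] [TopologicalSpace X]
    [IsTopologicalAddGroup X] [MeasurableSpace X] [BorelSpace X]
    (K : AddSubgroup X) [CompactSpace K] : Measure X :=
  (Measure.addHaarMeasure (⊤ : TopologicalSpace.PositiveCompacts K)).map (Subtype.val : K → X)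

/-!
The argument works directly with the weights of the distributions; no characteristic functions are
used.

Since the primary components of `X` are cyclic, the elements killed by the order of `x` are the
multiples of `x` (`mem_zmultiples_of_nsmul_eq_zero`). So `X` is countable, every subgroup is stable
under `α` and under division by `2`, and the symmetry condition is a statement about atoms: the law
of `(ξ₁ + ξ₂, ξ₁ + α ξ₂)` is invariant under negating the second coordinate (`HeydeSymmetric`).

Replace `ξ₁, ξ₂` by `ξ₁ + α z, ξ₂ - z` with `z` an atom of `μ₂`; this preserves the condition. Let
`D` be the subgroup generated by the support of the shifted `ξ₂`. For each `(x, y)` in the product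
of the supports there is a reflected pair `(x', y')`, also in that product, with the same sum and
with `x' + α y' = -(x + α y)`. From this one reads off that the shifted `ξ₁` lives in `D`, that
differences of its support points generate `D`, and that `(1 - α) D = D`
(`closure_le_and_surjOn_of_reflection`). As the components of `D` are finite, `1 - α` is even
invertible on `D` (`eq_zero_of_surjOn`). Hence `(x, y)` is determined by `(x + y, x + α y)`, the
reflected pair is a function of `(x, y)`, namely `(c x + (1 + c) y, (1 - c) x - c y)` with
`c = -(1 + α) (1 - α)⁻¹`, and the weights satisfy `F (c x + (1 + c) y) G ((1 - c) x - c y) = F x G y`.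

After normalizing the maxima to `1`, taking `x` to be a maximum point of `F` gives
`G y ≤ F (c x + (1 + c) y)`. Both sides have the same sum over `y`, so equality holds. Thus `F` is
periodic under `c K`, where `K` is the finite subgroup generated by the differences of maximum
points, and `c D ⊆ K`. Summing the relation over a coset of `K` extends the equality to every `x` in
the support of `F` (`IsReflectionPair.comp_affine_eq_of_ne_zero`), so `F` is periodic under all of
`c D = (1 + α) D`, which is finite, and then `F = G`. So both shifted distributions are one and the
same `λ`, invariant under `(1 + α) D`, and the symmetry property of `λ` is the one already known for
the shifted pair.
-/

/-! ### Torsion groups with cyclic primary components -/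

section LocallyCyclic

variable {X : Type*} [AddCommGroup X]

lemma finite_of_isAddCyclic_of_isAddTorsion {C : Type*} [AddGroup C] [hC : IsAddCyclic C]
    (htors : IsAddTorsion C) : Finite C := by
  obtain ⟨g, hg⟩ := hC.exists_generator
  have hfin : Finite (AddSubgroup.zmultiples g) := finite_zmultiples.2 (htors g)
  exact Finite.of_injective (fun x : C => (⟨x, hg x⟩ : AddSubgroup.zmultiples g))
    fun x y h => congrArg Subtype.val h

lemma mem_zmultiples_of_nsmul_eq_zero_of_isAddCyclic {C : Type*} [AddCommGroup C] [IsAddCyclic C]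
    [Finite C] {x y : C} (h : addOrderOf x • y = 0) : y ∈ AddSubgroup.zmultiples x := by
  classical
  have := Fintype.ofFinite C
  have hsub : (AddSubgroup.zmultiples x : Set C).toFinset ⊆
      Finset.univ.filter fun a : C => addOrderOf x • a = 0 := by
    intro a ha
    obtain ⟨k, rfl⟩ := AddSubgroup.mem_zmultiples_iff.1 (Set.mem_toFinset.1 ha)
    rw [Finset.mem_filter]
    exact ⟨Finset.mem_univ _, by rw [smul_comm, addOrderOf_nsmul_eq_zero, smul_zero]⟩
  have hcard := Finset.eq_of_subset_of_card_le hsub <| by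
    refine (IsAddCyclic.card_nsmul_eq_zero_le (addOrderOf_pos x)).trans ?_
    rw [Set.toFinset_card, ← Nat.card_eq_fintype_card]
    exact (Nat.card_zmultiples x).ge
  have hy : y ∈ Finset.univ.filter fun a : C => addOrderOf x • a = 0 := by simpa using h
  rw [← hcard] at hy
  exact Set.mem_toFinset.1 hy

/-- In a torsion group with cyclic primary components, the elements killed by the order of `x` are
the multiples of `x`. In particular every subgroup is stable under every endomorphism. -/
lemma mem_zmultiples_of_nsmul_eq_zero (htors : IsAddTorsion X)
    (hcyc : ∀ p : ℕ, p.Prime → IsAddCyclic (AddCommGroup.primaryComponent X p)) {x y : X}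
    (h : addOrderOf x • y = 0) : y ∈ AddSubgroup.zmultiples x := by
  induction hn : addOrderOf x using Nat.recOnPosPrimePosCoprime generalizing x y with
  | zero => exact absurd hn (htors x).addOrderOf_pos.ne'
  | one => simp_all
  | prime_pow p k hp _ =>
    rw [hn] at h
    have := hcyc p hp
    have hx : x ∈ AddCommGroup.primaryComponent X p :=
      AddCommGroup.mem_primaryComponent.2 ⟨k, hn ▸ addOrderOf_nsmul_eq_zero x⟩
    have hy : y ∈ AddCommGroup.primaryComponent X p :=
      AddCommGroup.mem_primaryComponent.2 ⟨k, h⟩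
    have := finite_of_isAddCyclic_of_isAddTorsion (htors.addSubgroup
      (AddCommGroup.primaryComponent X p))
    have hmem := mem_zmultiples_of_nsmul_eq_zero_of_isAddCyclic
      (x := (⟨x, hx⟩ : AddCommGroup.primaryComponent X p)) (y := ⟨y, hy⟩)
      (by rw [AddSubgroup.addOrderOf_mk, hn]; exact Subtype.ext h)
    obtain ⟨j, hj⟩ := AddSubgroup.mem_zmultiples_iff.1 hmem
    exact AddSubgroup.mem_zmultiples_iff.2 ⟨j, congrArg Subtype.val hj⟩
  | coprime a b ha hb hab iha ihb =>
    rw [hn] at h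
    have hax : addOrderOf (a • x) = b := by
      rw [addOrderOf_nsmul_of_dvd (by omega) (hn ▸ dvd_mul_right a b), hn,
        Nat.mul_div_cancel_left _ (by omega)]
    have hbx : addOrderOf (b • x) = a := by
      rw [addOrderOf_nsmul_of_dvd (by omega) (hn ▸ dvd_mul_left b a), hn,
        Nat.mul_div_cancel _ (by omega)]
    have h1 : a • y ∈ AddSubgroup.zmultiples x :=
      AddSubgroup.zmultiples_le_of_mem
        (AddSubgroup.nsmul_mem _ (AddSubgroup.mem_zmultiples x) a)
        (ihb (by rw [hax, smul_smul, mul_comm, h]) hax)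
    have h2 : b • y ∈ AddSubgroup.zmultiples x :=
      AddSubgroup.zmultiples_le_of_mem
        (AddSubgroup.nsmul_mem _ (AddSubgroup.mem_zmultiples x) b)
        (iha (by rw [hbx, smul_smul, h]) hbx)
    have hbez : (a : ℤ) * a.gcdA b + b * a.gcdB b = 1 := by
      rw [← Nat.gcd_eq_gcd_ab, hab, Nat.cast_one]
    have hy : y = a.gcdA b • a • y + a.gcdB b • b • y := by
      rw [← natCast_zsmul y a, ← natCast_zsmul y b, smul_smul, smul_smul, ← add_smul,
        mul_comm, mul_comm (a.gcdB b), hbez, one_smul]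
    rw [hy]
    exact add_mem (AddSubgroup.zsmul_mem _ h1 _) (AddSubgroup.zsmul_mem _ h2 _)

lemma countable_of_isAddTorsion_of_isAddCyclic (htors : IsAddTorsion X)
    (hcyc : ∀ p : ℕ, p.Prime → IsAddCyclic (AddCommGroup.primaryComponent X p)) :
    Countable X := by
  rw [← Set.countable_univ_iff]
  have hcover : (Set.univ : Set X) = ⋃ n : ℕ, {x | addOrderOf x = n} := by ext; simp
  rw [hcover]
  refine Set.countable_iUnion fun n => ?_
  rcases Set.eq_empty_or_nonempty {x : X | addOrderOf x = n} with h | ⟨x, hx⟩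
  · simp [h]
  · have hfin : Finite (AddSubgroup.zmultiples x) := finite_zmultiples.2 (htors x)
    refine ((Set.toFinite (AddSubgroup.zmultiples x : Set X)).subset fun y hy => ?_).countable
    refine mem_zmultiples_of_nsmul_eq_zero htors hcyc ?_
    have hxy : addOrderOf x = addOrderOf y := Eq.trans hx (Eq.symm hy)
    rw [hxy, addOrderOf_nsmul_eq_zero]

lemma map_mem_of_mem (htors : IsAddTorsion X)
    (hcyc : ∀ p : ℕ, p.Prime → IsAddCyclic (AddCommGroup.primaryComponent X p))
    (f : X →+ X) {H : AddSubgroup X} {x : X} (hx : x ∈ H) : f x ∈ H :=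
  AddSubgroup.zmultiples_le_of_mem hx <| mem_zmultiples_of_nsmul_eq_zero htors hcyc <| by
    rw [← map_nsmul, addOrderOf_nsmul_eq_zero, map_zero]

lemma apply_equiv_mem_iff (htors : IsAddTorsion X)
    (hcyc : ∀ p : ℕ, p.Prime → IsAddCyclic (AddCommGroup.primaryComponent X p))
    (f : X ≃+ X) {H : AddSubgroup X} {x : X} : f x ∈ H ↔ x ∈ H :=
  ⟨fun h => by simpa using map_mem_of_mem htors hcyc f.symm.toAddMonoidHom h,
    fun h => map_mem_of_mem htors hcyc f.toAddMonoidHom h⟩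

lemma eq_zero_of_two_nsmul_eq_zero (h2 : ∀ x : X, addOrderOf x ≠ 2) {x : X} (h : 2 • x = 0) :
    x = 0 := by
  by_contra hx
  exact h2 x (addOrderOf_eq_prime h hx)

lemma two_nsmul_mem_iff (htors : IsAddTorsion X)
    (hcyc : ∀ p : ℕ, p.Prime → IsAddCyclic (AddCommGroup.primaryComponent X p))
    (h2 : ∀ x : X, addOrderOf x ≠ 2) {H : AddSubgroup X} {x : X} : 2 • x ∈ H ↔ x ∈ H := by
  refine ⟨fun h => ?_, fun h => H.nsmul_mem h 2⟩
  refine AddSubgroup.zmultiples_le_of_mem h (mem_zmultiples_of_nsmul_eq_zero htors hcyc ?_)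
  refine eq_zero_of_two_nsmul_eq_zero h2 ?_
  rw [smul_comm, addOrderOf_nsmul_eq_zero]

/-- An endomorphism `f` with `f H = H` is injective on `H`: by Bézout it maps each primary component
of `H` onto itself, and these components are finite. -/
lemma eq_zero_of_surjOn (htors : IsAddTorsion X)
    (hcyc : ∀ p : ℕ, p.Prime → IsAddCyclic (AddCommGroup.primaryComponent X p))
    (f : X →+ X) {H : AddSubgroup X} (hf : ∀ w ∈ H, ∃ y ∈ H, f y = w) {z : X} (hz : z ∈ H)
    (hfz : f z = 0) : z = 0 := by
  by_contra hne
  set n := addOrderOf z with hn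
  have hn1 : n ≠ 1 := by simpa [hn] using hne
  have hn0 : 0 < n := (htors z).addOrderOf_pos
  set p := n.minFac with hp_def
  have hp : p.Prime := Nat.minFac_prime hn1
  have := hcyc p hp
  have := finite_of_isAddCyclic_of_isAddTorsion (htors.addSubgroup
    (AddCommGroup.primaryComponent X p))
  set D : AddSubgroup X := H ⊓ AddCommGroup.primaryComponent X p with hD
  have hDfin : Finite D := Set.Finite.subset
    (Set.toFinite (AddCommGroup.primaryComponent X p : Set X)) inf_le_right
  let g : D → D := fun x => ⟨f x, map_mem_of_mem htors hcyc f x.2⟩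
  have hsurj : Function.Surjective g := by
    rintro ⟨w, hwH, hwp⟩
    obtain ⟨k, hk⟩ := AddCommGroup.mem_primaryComponent.1 hwp
    obtain ⟨y, hyH, rfl⟩ := hf w hwH
    obtain ⟨j, r, hr, hjr⟩ := Nat.exists_eq_pow_mul_and_not_dvd
      (htors y).addOrderOf_pos.ne' p hp.ne_one
    have hcop : Nat.Coprime r (p ^ k) :=
      (((Nat.Prime.coprime_iff_not_dvd hp).2 hr).pow_left k).symm
    have hbez : (r : ℤ) * r.gcdA (p ^ k) + (p ^ k : ℕ) * r.gcdB (p ^ k) = 1 := by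
      rw [← Nat.gcd_eq_gcd_ab, hcop, Nat.cast_one]
    refine ⟨⟨r.gcdA (p ^ k) • r • y, H.zsmul_mem (H.nsmul_mem hyH _) _,
      AddCommGroup.mem_primaryComponent.2 ⟨j, ?_⟩⟩, Subtype.ext ?_⟩
    · rw [smul_comm, smul_smul, ← hjr, addOrderOf_nsmul_eq_zero, smul_zero]
    · change f _ = f y
      have h1 : f y = r.gcdA (p ^ k) • r • f y + r.gcdB (p ^ k) • p ^ k • f y := by
        rw [← natCast_zsmul (f y) r, ← natCast_zsmul (f y) (p ^ k), smul_smul, smul_smul,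
          ← add_smul, mul_comm, mul_comm (r.gcdB _), hbez, one_smul]
      rw [hk, smul_zero, add_zero] at h1
      rw [map_zsmul, map_nsmul, ← h1]
  have hinj : Function.Injective g := Finite.injective_iff_surjective.2 hsurj
  have hpn : p * (n / p) = n := Nat.mul_div_cancel' n.minFac_dvd
  have hz' : (n / p) • z ∈ D := ⟨H.nsmul_mem hz _, AddCommGroup.mem_primaryComponent.2
    ⟨1, by rw [pow_one, smul_smul, hpn, hn, addOrderOf_nsmul_eq_zero]⟩⟩
  have h0 : (⟨(n / p) • z, hz'⟩ : D) = 0 := hinj <| Subtype.ext <| by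
    change f _ = f _
    rw [map_nsmul, hfz, smul_zero]
    exact (map_zero f).symm
  have hlt : n / p < n := Nat.div_lt_self hn0 hp.one_lt
  exact absurd (Nat.le_of_dvd (Nat.div_pos (Nat.minFac_le hn0) hp.pos)
    (addOrderOf_dvd_of_nsmul_eq_zero (congrArg Subtype.val h0))) (not_le.2 hlt)

end LocallyCyclic

/-! ### Functions invariant under a reflection of the square of a group -/

section ReflectionPair

variable {D : Type*} [AddCommGroup D]

/-- Two nonnegative summable functions with maximum `1` whose tensor product is invariant under the
map `(x, y) ↦ (c x + (1 + c) y, (1 - c) x - c y)`, where `1 - c` and `1 + c` are bijective. -/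
structure IsReflectionPair (c : D →+ D) (F G : D → ℝ) : Prop where
  nonneg_left : ∀ x, 0 ≤ F x
  nonneg_right : ∀ x, 0 ≤ G x
  summable_left : Summable F
  summable_right : Summable G
  le_one_left : ∀ x, F x ≤ 1
  le_one_right : ∀ x, G x ≤ 1
  exists_eq_one_left : ∃ x, F x = 1
  exists_eq_one_right : ∃ x, G x = 1
  bijective_sub : Function.Bijective fun x => x - c x
  bijective_add : Function.Bijective fun x => x + c x
  invariant : ∀ x y, F (c x + (y + c y)) * G (x - c x - c y) = F x * G y

namespace IsReflectionPair

variable {c : D →+ D} {F G : D → ℝ}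

/-- Exchanging the two coordinates replaces `c` by `-c`. -/
lemma symm (h : IsReflectionPair c F G) : IsReflectionPair (-c) G F where
  nonneg_left := h.nonneg_right
  nonneg_right := h.nonneg_left
  summable_left := h.summable_right
  summable_right := h.summable_left
  le_one_left := h.le_one_right
  le_one_right := h.le_one_left
  exists_eq_one_left := h.exists_eq_one_right
  exists_eq_one_right := h.exists_eq_one_left
  bijective_sub := by simpa using h.bijective_add
  bijective_add := by simpa [sub_eq_add_neg] using h.bijective_sub
  invariant x y := by
    rw [mul_comm (G x), ← h.invariant y x, mul_comm]
    congr 2 <;> simp only [AddMonoidHom.neg_apply] <;> abel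

lemma bijective_affine (h : IsReflectionPair c F G) (x : D) :
    Function.Bijective fun y => c x + (y + c y) :=
  (AddGroup.addLeft_bijective (c x)).comp h.bijective_add

lemma le_comp_affine (h : IsReflectionPair c F G) {x : D} (hx : F x = 1) (y : D) :
    G y ≤ F (c x + (y + c y)) := by
  have := h.invariant x y
  rw [hx, one_mul] at this
  rw [← this]
  exact mul_le_of_le_one_right (h.nonneg_left _) (h.le_one_right _)

lemma tsum_le (h : IsReflectionPair c F G) : ∑' x, G x ≤ ∑' x, F x := by
  obtain ⟨x, hx⟩ := h.exists_eq_one_left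
  let e := Equiv.ofBijective _ (h.bijective_affine x)
  rw [← e.tsum_eq F]
  exact h.summable_right.tsum_le_tsum (h.le_comp_affine hx) (e.summable_iff.2 h.summable_left)

lemma tsum_eq (h : IsReflectionPair c F G) : ∑' x, G x = ∑' x, F x :=
  le_antisymm h.tsum_le h.symm.tsum_le

/-- As `F` and `G` have the same sum, `G` cannot lie below a translate of `F` without being equal
to it. -/
lemma comp_affine_eq_of_le (h : IsReflectionPair c F G) {x : D}
    (hx : ∀ y, G y ≤ F (c x + (y + c y))) (y : D) : F (c x + (y + c y)) = G y := by
  by_contra hne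
  let e := Equiv.ofBijective _ (h.bijective_affine x)
  have hlt : ∑' y, G y < ∑' y, F (e y) := Summable.tsum_lt_tsum (i := y) hx
    (lt_of_le_of_ne (hx y) (Ne.symm hne)) h.summable_right (e.summable_iff.2 h.summable_left)
  rw [e.tsum_eq F, h.tsum_eq] at hlt
  exact lt_irrefl _ hlt

lemma comp_affine_eq (h : IsReflectionPair c F G) {x : D} (hx : F x = 1) (y : D) :
    F (c x + (y + c y)) = G y :=
  h.comp_affine_eq_of_le (h.le_comp_affine hx) y

lemma comp_affine_eq' (h : IsReflectionPair c F G) {y : D} (hy : G y = 1) (x : D) :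
    G (x - c x - c y) = F x := by
  rw [← h.symm.comp_affine_eq hy x]
  congr 1
  simp only [AddMonoidHom.neg_apply]
  abel

lemma comp_affine_eq_one' (h : IsReflectionPair c F G) {x y : D} (hx : F x = 1) (hy : G y ≠ 0) :
    G (x - c x - c y) = 1 := by
  have := h.invariant x y
  rw [h.comp_affine_eq hx, hx, one_mul] at this
  exact mul_left_cancel₀ hy (this.trans (mul_one _).symm)

lemma comp_affine_eq_one (h : IsReflectionPair c F G) {x y : D} (hx : F x ≠ 0) (hy : G y = 1) :
    F (c x + (y + c y)) = 1 := by
  have := h.invariant x y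
  rw [h.comp_affine_eq' hy, hy, mul_one] at this
  exact mul_right_cancel₀ hx (this.trans (one_mul _).symm)

/-- The subgroup generated by the differences of maximum points of `F`. -/
def maxDiff (F : D → ℝ) : AddSubgroup D :=
  AddSubgroup.closure {z | ∃ x x', F x = 1 ∧ F x' = 1 ∧ z = x - x'}

lemma finite_maxDiff (h : IsReflectionPair c F G) (htors : IsAddTorsion D) :
    Finite (maxDiff F) := by
  have hmax : {x | F x = 1}.Finite := by
    have hev := h.summable_left.tendsto_cofinite_zero.eventually (gt_mem_nhds one_pos)
    refine (Filter.eventually_cofinite.1 hev).subset fun x hx => ?_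
    exact not_lt.2 (ge_of_eq hx)
  have hfin : {z | ∃ x x', F x = 1 ∧ F x' = 1 ∧ z = x - x'}.Finite := by
    refine (hmax.image2 (fun x x' => x - x') hmax).subset ?_
    rintro z ⟨x, x', hx, hx', rfl⟩
    exact ⟨x, hx, x', hx', rfl⟩
  have : AddGroup.FG (maxDiff F) := (AddGroup.fg_iff_addSubgroup_fg _).2
    ((AddSubgroup.fg_iff _).2 ⟨_, rfl, hfin⟩)
  exact AddCommGroup.finite_of_fg_isAddTorsion _ (htors.addSubgroup _)

/-- The subgroup of periods of a function on a group. -/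
def periods (F : D → ℝ) : AddSubgroup D where
  carrier := {t | ∀ x, F (x + t) = F x}
  zero_mem' x := by rw [add_zero]
  add_mem' {s t} hs ht x := by rw [← add_assoc, ht, hs]
  neg_mem' {t} ht x := by rw [← ht (x + -t), neg_add_cancel_right]

/-- If the affine reparametrizations of `F` by `x` and by `x'` agree, then `c (x - x')` is a
period of `F`. -/
lemma map_sub_mem_periods (h : IsReflectionPair c F G) {x x' : D}
    (hx : ∀ y, F (c x + (y + c y)) = G y) (hx' : ∀ y, F (c x' + (y + c y)) = G y) :
    c (x - x') ∈ periods F := by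
  intro z
  obtain ⟨y, rfl⟩ := (h.bijective_affine x').2 z
  beta_reduce
  rw [hx', ← hx y, map_sub]
  congr 1
  abel

lemma map_mem_periods_of_mem_maxDiff (h : IsReflectionPair c F G) {t : D} (ht : t ∈ maxDiff F) :
    c t ∈ periods F := by
  have hle : maxDiff F ≤ (periods F).comap c := by
    refine (AddSubgroup.closure_le _).2 ?_
    rintro z ⟨x, x', hx, hx', rfl⟩
    exact h.map_sub_mem_periods (h.comp_affine_eq hx) (h.comp_affine_eq hx')
  exact hle ht

/-- Summing the invariance relation over a coset of the finite group `maxDiff F`, on whose image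
under `c` the function `F` is periodic, extends `comp_affine_eq` from the maximum points of `F` to
its whole support. -/
lemma comp_affine_eq_of_ne_zero (h : IsReflectionPair c F G) (htors : IsAddTorsion D) {x : D}
    (hx : F x ≠ 0) (y : D) : F (c x + (y + c y)) = G y := by
  refine h.comp_affine_eq_of_le (fun y => ?_) y
  by_cases hy : G y = 0
  · rw [hy]; exact h.nonneg_left _
  refine ge_of_eq ?_
  obtain ⟨n, hn⟩ := h.exists_eq_one_right
  obtain ⟨m, hm⟩ := h.exists_eq_one_left
  have := h.finite_maxDiff htors
  have := Fintype.ofFinite (maxDiff F)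
  -- `c (n - y)` is a difference of maximum points of `G`, and these are the images of the maximum
  -- points of `F` under `z ↦ (1 - c) z - c n`.
  obtain ⟨k, hk, hkc⟩ : ∃ k ∈ maxDiff F, k - c k = c (n - y) := by
    obtain ⟨z, hz⟩ := h.bijective_sub.2 (m - c m - c y + c n)
    have hz' : z - c z = m - c m - c y + c n := hz
    refine ⟨z - m, AddSubgroup.subset_closure ⟨z, m, ?_, hm, rfl⟩, ?_⟩
    · rw [← h.comp_affine_eq' hn z, hz', add_sub_cancel_right, h.comp_affine_eq_one' hm hy]
    · rw [map_sub, map_sub, sub_sub_sub_comm, hz']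
      abel
  have hterm : ∀ t : maxDiff F,
      F (c x + (y + c y)) * F (x + t + k) = F (x + t) * G y := by
    intro t
    rw [← h.invariant (x + t) y, ← h.comp_affine_eq' hn (x + t + k)]
    congr 1
    · rw [← h.map_mem_periods_of_mem_maxDiff t.2 (c x + (y + c y)), map_add]
      congr 1
      abel
    · congr 1
      have : x + t + k - c (x + t + k) - c n = x + t - c (x + t) + (k - c k) - c n := by
        rw [map_add c (x + t)]; abel
      rw [this, hkc, map_sub]
      abel
  have hshift : ∑ t : maxDiff F, F (x + t + k) = ∑ t : maxDiff F, F (x + t) := by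
    refine Fintype.sum_equiv (Equiv.addRight (⟨k, hk⟩ : maxDiff F)) _ _ fun t => ?_
    simp [add_assoc]
  have hsum := Finset.sum_congr (rfl : (Finset.univ : Finset (maxDiff F)) = _)
    fun t _ => hterm t
  rw [← Finset.mul_sum, ← Finset.sum_mul, hshift, mul_comm _ (G y)] at hsum
  have hpos : 0 < ∑ t : maxDiff F, F (x + t) :=
    Finset.sum_pos' (fun t _ => h.nonneg_left _)
      ⟨0, Finset.mem_univ _, by simpa using lt_of_le_of_ne (h.nonneg_left x) (Ne.symm hx)⟩
  exact mul_right_cancel₀ hpos.ne' hsum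

lemma map_mem_periods (h : IsReflectionPair c F G) (htors : IsAddTorsion D)
    (hgen : AddSubgroup.closure {z | ∃ x x', F x ≠ 0 ∧ F x' ≠ 0 ∧ z = x - x'} = ⊤)
    (t : D) : c t ∈ periods F := by
  have hle : (⊤ : AddSubgroup D) ≤ (periods F).comap c := by
    rw [← hgen, AddSubgroup.closure_le]
    rintro z ⟨x, x', hx, hx', rfl⟩
    exact h.map_sub_mem_periods (h.comp_affine_eq_of_ne_zero htors hx)
      (h.comp_affine_eq_of_ne_zero htors hx')
  exact hle (AddSubgroup.mem_top t)

lemma map_mem_maxDiff (h : IsReflectionPair c F G)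
    (hgen : AddSubgroup.closure {z | ∃ x x', F x ≠ 0 ∧ F x' ≠ 0 ∧ z = x - x'} = ⊤)
    (t : D) : c t ∈ maxDiff F := by
  obtain ⟨n, hn⟩ := h.exists_eq_one_right
  have hle : (⊤ : AddSubgroup D) ≤ (maxDiff F).comap c := by
    rw [← hgen, AddSubgroup.closure_le]
    rintro z ⟨x, x', hx, hx', rfl⟩
    refine AddSubgroup.subset_closure
      ⟨_, _, h.comp_affine_eq_one hx hn, h.comp_affine_eq_one hx' hn, ?_⟩
    rw [map_sub]
    abel
  exact hle (AddSubgroup.mem_top t)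

lemma finite_range (h : IsReflectionPair c F G) (htors : IsAddTorsion D)
    (hgen : AddSubgroup.closure {z | ∃ x x', F x ≠ 0 ∧ F x' ≠ 0 ∧ z = x - x'} = ⊤) :
    Finite c.range := by
  have := h.finite_maxDiff htors
  refine Set.Finite.subset (Set.toFinite (maxDiff F : Set D)) ?_
  rintro _ ⟨t, rfl⟩
  exact h.map_mem_maxDiff hgen t

lemma eq_right (h : IsReflectionPair c F G) (htors : IsAddTorsion D)
    (hgen : AddSubgroup.closure {z | ∃ x x', F x ≠ 0 ∧ F x' ≠ 0 ∧ z = x - x'} = ⊤) :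
    F = G := by
  obtain ⟨m, hm⟩ := h.exists_eq_one_left
  ext y
  rw [← h.comp_affine_eq hm y, ← h.map_mem_periods htors hgen (m + y) y, map_add]
  congr 1
  abel

end IsReflectionPair

end ReflectionPair

/-! ### The symmetry condition in terms of atoms -/

section HeydeSymmetry

lemma prod_singleton_eq_mul {Y : Type*} [MeasurableSpace Y] {μ ν : Measure Y} [SFinite ν]
    (x y : Y) :
    (μ.prod ν) {(x, y)} = μ {x} * ν {y} := by
  rw [← Set.singleton_prod_singleton, Measure.prod_prod]

lemma exists_mem_singleton_ne_zero {Y : Type*} [Countable Y] [MeasurableSpace Y]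
    {m : Measure Y} {S : Set Y} (hS : m S ≠ 0) : ∃ p ∈ S, m {p} ≠ 0 := by
  by_contra! h
  refine hS (measure_eq_zero_iff_ae_notMem.2 (ae_iff_of_countable.2 fun p hp hpS => hp (h p hpS)))

variable {X : Type*} [AddCommGroup X] [MeasurableSpace X]

/-- The functional form of the symmetry condition: if `x` and `y` are independent with laws `μ` and
`ν`, then `(x + y, x + α y)` and `(x + y, -(x + α y))` have the same law. On a countable group it is
enough to compare atoms. -/
def HeydeSymmetric (α : X ≃+ X) (μ ν : Measure X) : Prop :=
  ∀ s t : X, (μ.prod ν) {p | p.1 + p.2 = s ∧ p.1 + α p.2 = t} =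
    (μ.prod ν) {p | p.1 + p.2 = s ∧ p.1 + α p.2 = -t}

variable [Countable X]

lemma HeydeSymmetric.exists_reflection {α : X ≃+ X} {μ ν : Measure X} [SFinite ν]
    (h : HeydeSymmetric α μ ν) {x y : X} (hx : μ {x} ≠ 0) (hy : ν {y} ≠ 0) :
    ∃ x' y', μ {x'} ≠ 0 ∧ ν {y'} ≠ 0 ∧ x' + y' = x + y ∧ x' + α y' = -(x + α y) := by
  have hne : (μ.prod ν) {p | p.1 + p.2 = x + y ∧ p.1 + α p.2 = x + α y} ≠ 0 := by
    refine fun h0 => mul_ne_zero hx hy ?_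
    rw [← prod_singleton_eq_mul]
    refine measure_mono_null (Set.singleton_subset_iff.2 ?_) h0
    exact ⟨rfl, rfl⟩
  rw [h] at hne
  obtain ⟨⟨x', y'⟩, ⟨h1, h2⟩, hp⟩ := exists_mem_singleton_ne_zero hne
  rw [prod_singleton_eq_mul] at hp
  exact ⟨x', y', left_ne_zero_of_mul hp, right_ne_zero_of_mul hp, h1, h2⟩

/-- If `1 - α` is injective on a subgroup carrying `ν`, the map `(x, y) ↦ (x + y, x + α y)` is
injective where `ν` lives, so the symmetry condition is a pointwise identity of weights. -/
lemma HeydeSymmetric.mul_singleton_eq {α : X ≃+ X} {μ ν : Measure X} [SFinite ν]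
    (h : HeydeSymmetric α μ ν) {D : AddSubgroup X} (hD : ∀ y, ν {y} ≠ 0 → y ∈ D)
    (hinj : ∀ z ∈ D, z - α z = 0 → z = 0) {x y x' y' : X} (hy : y ∈ D) (hy' : y' ∈ D)
    (hadd : x' + y' = x + y) (hlin : x' + α y' = -(x + α y)) :
    μ {x'} * ν {y'} = μ {x} * ν {y} := by
  have key : ∀ a b, b ∈ D → (μ.prod ν) {p | p.1 + p.2 = a + b ∧ p.1 + α p.2 = a + α b} =
      μ {a} * ν {b} := by
    intro a b hb
    rw [← prod_singleton_eq_mul]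
    refine measure_congr (ae_iff_of_countable.2 ?_)
    rintro ⟨u, v⟩ hp
    rw [prod_singleton_eq_mul] at hp
    have hv : v ∈ D := hD v (right_ne_zero_of_mul hp)
    refine propext ⟨?_, ?_⟩
    · rintro ⟨h1, h2⟩
      have hvb : v - b = 0 := by
        refine hinj _ (D.sub_mem hv hb) ?_
        rw [map_sub]
        have h3 : u + v - (u + α v) = a + b - (a + α b) := congrArg₂ (· - ·) h1 h2
        rw [add_sub_add_left_eq_sub, add_sub_add_left_eq_sub] at h3
        rw [sub_sub_sub_comm, h3, sub_self]
      obtain rfl := sub_eq_zero.1 hvb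
      exact Prod.ext (add_right_cancel h1) rfl
    · intro huv
      obtain ⟨rfl, rfl⟩ := Prod.ext_iff.1 huv
      exact ⟨rfl, rfl⟩
  rw [← key x' y' hy', ← key x y hy, hadd, hlin, ← h]

variable [MeasurableSingletonClass X]

lemma condDistribIsSymmetric_iff_forall_singleton {Ω : Type*} [MeasurableSpace Ω] {P : Measure Ω}
    [IsProbabilityMeasure P] {L₁ L₂ : Ω → X} (h₁ : AEMeasurable L₁ P) (h₂ : AEMeasurable L₂ P) :
    CondDistribIsSymmetric L₂ L₁ P ↔ ∀ s t, P.map (fun ω => (L₁ ω, L₂ ω)) {(s, t)} =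
      P.map (fun ω => (L₁ ω, L₂ ω)) {(s, -t)} := by
  have key : ∀ κ : Kernel X X, IsMarkovKernel κ → HasCondDistrib L₂ L₁ κ P → ∀ s t,
      P.map (fun ω => (L₁ ω, L₂ ω)) {(s, t)} = κ s {t} * P.map L₁ {s} := by
    intro κ _ hκ s t
    rw [hκ.map_eq, ← Set.singleton_prod_singleton,
      Measure.compProd_apply_prod (.singleton s) (.singleton t), lintegral_singleton]
  have hneg : ∀ (m : Measure X) (t : X), m.map (fun t : X => -t) {t} = m {-t} := by
    intro m t
    rw [Measure.map_apply .of_discrete (.singleton t)]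
    congr 1
    ext x
    simp
  constructor
  · rintro ⟨κ, hκ, hL, hsymm⟩ s t
    rw [key κ hκ hL, key κ hκ hL]
    by_cases hs : P.map L₁ {s} = 0
    · rw [hs, mul_zero, mul_zero]
    · rw [← hneg, ae_iff_of_countable.1 hsymm s hs]
  · intro h
    have hL : HasCondDistrib L₂ L₁ (condDistrib L₂ L₁ P) P :=
      ⟨h₁.prodMk h₂, (compProd_map_condDistrib h₂).symm⟩
    refine ⟨condDistrib L₂ L₁ P, inferInstance, hL, ae_iff_of_countable.2 fun s hs => ?_⟩
    refine Measure.ext_of_singleton fun t => ?_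
    have := h s t
    rw [key _ inferInstance hL, key _ inferInstance hL,
      ENNReal.mul_left_inj hs (measure_ne_top _ _)] at this
    rw [hneg, this]

lemma condDistribIsSymmetric_iff_heydeSymmetric {Ω : Type*} [MeasurableSpace Ω] {P : Measure Ω}
    [IsProbabilityMeasure P] {ξ₁ ξ₂ : Ω → X} {μ ν : Measure X} (α : X ≃+ X)
    (h₁ : HasLaw ξ₁ μ P) (h₂ : HasLaw ξ₂ ν P) (hindep : IndepFun ξ₁ ξ₂ P) :
    CondDistribIsSymmetric (fun ω => ξ₁ ω + α (ξ₂ ω)) (fun ω => ξ₁ ω + ξ₂ ω) P ↔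
      HeydeSymmetric α μ ν := by
  have hm₁ := h₁.aemeasurable
  have hm₂ := h₂.aemeasurable
  have hadd : AEMeasurable (fun ω => ξ₁ ω + ξ₂ ω) P :=
    (Measurable.of_discrete (f := fun p : X × X => p.1 + p.2)).comp_aemeasurable (hm₁.prodMk hm₂)
  have hlin : AEMeasurable (fun ω => ξ₁ ω + α (ξ₂ ω)) P :=
    (Measurable.of_discrete (f := fun p : X × X => p.1 + α p.2)).comp_aemeasurable
      (hm₁.prodMk hm₂)
  have hprod : P.map (fun ω => (ξ₁ ω, ξ₂ ω)) = μ.prod ν := by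
    rw [(indepFun_iff_map_prod_eq_prod_map_map hm₁ hm₂).1 hindep, h₁.map_eq, h₂.map_eq]
  have hmap : ∀ s t, P.map (fun ω => (ξ₁ ω + ξ₂ ω, ξ₁ ω + α (ξ₂ ω))) {(s, t)} =
      (μ.prod ν) {p | p.1 + p.2 = s ∧ p.1 + α p.2 = t} := by
    intro s t
    rw [← hprod, Measure.map_apply_of_aemeasurable (hadd.prodMk hlin) (.singleton _),
      Measure.map_apply_of_aemeasurable (hm₁.prodMk hm₂) .of_discrete]
    congr 1
    ext ω
    simp
  rw [condDistribIsSymmetric_iff_forall_singleton hadd hlin]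
  simp only [hmap]
  rfl

lemma HeydeSymmetric.shift {α : X ≃+ X} {μ ν : Measure X} [SFinite μ] [SFinite ν]
    (h : HeydeSymmetric α μ ν) (z : X) :
    HeydeSymmetric α (μ.map fun x => x + α z) (ν.map fun y => y - z) := by
  have key : ∀ s t, ((μ.map fun x => x + α z).prod (ν.map fun y => y - z))
      {p | p.1 + p.2 = s ∧ p.1 + α p.2 = t} =
      (μ.prod ν) {p | p.1 + p.2 = s - α z + z ∧ p.1 + α p.2 = t} := by
    intro s t
    rw [Measure.map_prod_map _ _ .of_discrete .of_discrete,
      Measure.map_apply .of_discrete .of_discrete]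
    congr 1
    ext p
    refine and_congr ?_ ?_
    · change p.1 + α z + (p.2 - z) = s ↔ _
      rw [← sub_eq_zero, ← sub_eq_zero (b := s - α z + z)]
      refine Eq.congr ?_ rfl
      abel
    · change p.1 + α z + α (p.2 - z) = t ↔ _
      rw [map_sub]
      refine Eq.congr ?_ rfl
      abel
  intro s t
  rw [key, key, h]

end HeydeSymmetry

/-! ### Centred pairs with the symmetry property -/

section Structure

variable {X : Type*} [AddCommGroup X]

lemma sub_apply_mem (htors : IsAddTorsion X)
    (hcyc : ∀ p : ℕ, p.Prime → IsAddCyclic (AddCommGroup.primaryComponent X p))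
    (α : X ≃+ X) {H : AddSubgroup X} {x : X} (hx : x ∈ H) : x - α x ∈ H :=
  H.sub_mem hx ((apply_equiv_mem_iff htors hcyc α).2 hx)

/-- Both supports generate the same subgroup, and `1 - α` maps it onto itself. If `(x', y')` is the
reflection of `(x, y)`, then `(1 - α) (y + y') = 2 (x + y)` and `(1 - α) (x + x') = -2 α (x + y)`;
multiplication by `2` and `α` are invertible on every subgroup. -/
lemma closure_le_and_surjOn_of_reflection (htors : IsAddTorsion X)
    (hcyc : ∀ p : ℕ, p.Prime → IsAddCyclic (AddCommGroup.primaryComponent X p))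
    (h2 : ∀ x : X, addOrderOf x ≠ 2) (α : X ≃+ X) {A B : Set X} (hA : A.Nonempty)
    (hB : (0 : X) ∈ B)
    (hAB : ∀ x ∈ A, ∀ y ∈ B, ∃ x' ∈ A, ∃ y' ∈ B, x' + y' = x + y ∧ x' + α y' = -(x + α y)) :
    A ⊆ AddSubgroup.closure B ∧
      AddSubgroup.closure B ≤ AddSubgroup.closure {z | ∃ x ∈ A, ∃ x' ∈ A, z = x - x'} ∧
      ∀ w ∈ AddSubgroup.closure B, ∃ u ∈ AddSubgroup.closure B, u - α u = w := by
  have hsubset : A ⊆ AddSubgroup.closure B := by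
    intro x hx
    obtain ⟨x', -, y', hy', h1, h3⟩ := hAB x hx 0 hB
    refine (two_nsmul_mem_iff htors hcyc h2).1 ?_
    have : 2 • x = y' - α y' := by
      rw [map_zero, add_zero] at h3
      rw [add_zero] at h1
      have h4 : y' - α y' = x' + y' - (x' + α y') := by abel
      rw [h4, h1, h3]
      abel
    rw [this]
    exact sub_apply_mem htors hcyc α (AddSubgroup.subset_closure hy')
  set E := AddSubgroup.closure {z | ∃ x ∈ A, ∃ x' ∈ A, z = x - x'} with hE
  have hEB : E ≤ AddSubgroup.closure B := by
    refine (AddSubgroup.closure_le _).2 ?_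
    rintro z ⟨x, hx, x', hx', rfl⟩
    exact AddSubgroup.sub_mem _ (hsubset hx) (hsubset hx')
  obtain ⟨x, hx⟩ := hA
  have key : ∀ y ∈ B, ∃ u ∈ E, u - α u = 2 • α y := by
    intro y hy
    obtain ⟨x₁, hx₁, y₁, -, h1, h3⟩ := hAB x hx 0 hB
    obtain ⟨x₂, hx₂, y₂, -, h4, h5⟩ := hAB x hx y hy
    refine ⟨x₁ - x₂, AddSubgroup.subset_closure ⟨x₁, hx₁, x₂, hx₂, rfl⟩, ?_⟩
    have e : ∀ a b z : X, a + b = x + z → a + α b = -(x + α z) →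
        a - α a = -(x + α z) - (α x + α z) := by
      intro a b z h h'
      rw [← h', ← map_add α x, ← h, map_add]
      abel
    rw [map_sub, sub_sub_sub_comm, e _ _ _ h1 h3, e _ _ _ h4 h5, map_zero]
    abel
  have hBE : AddSubgroup.closure B ≤ E := by
    refine (AddSubgroup.closure_le _).2 fun y hy => ?_
    obtain ⟨u, hu, h⟩ := key y hy
    rw [SetLike.mem_coe, ← apply_equiv_mem_iff htors hcyc α, ← two_nsmul_mem_iff htors hcyc h2, ← h]
    exact sub_apply_mem htors hcyc α hu
  refine ⟨hsubset, hBE, ?_⟩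
  have hle : AddSubgroup.closure B ≤
      (AddSubgroup.closure B).map (AddMonoidHom.id X - α.toAddMonoidHom) := by
    refine (AddSubgroup.closure_le _).2 fun y hy => ?_
    obtain ⟨u, hu, h⟩ := key y hy
    rw [SetLike.mem_coe, ← apply_equiv_mem_iff htors hcyc α, ← two_nsmul_mem_iff htors hcyc h2, ← h]
    exact ⟨u, hEB hu, rfl⟩
  intro w hw
  obtain ⟨u, hu, h⟩ := hle hw
  exact ⟨u, hu, h⟩

lemma exists_forall_le_of_summable {ι : Type*} {f : ι → ℝ} (hf : Summable f) {i : ι}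
    (hi : 0 < f i) : ∃ m, ∀ j, f j ≤ f m := by
  have hfin : {j | f i ≤ f j}.Finite := by
    refine (Filter.eventually_cofinite.1
      (hf.tendsto_cofinite_zero.eventually (gt_mem_nhds hi))).subset fun j hj => ?_
    exact not_lt.2 hj
  obtain ⟨m, hm, hmax⟩ := hfin.exists_maximalFor f _ ⟨i, le_refl (f i)⟩
  refine ⟨m, fun j => ?_⟩
  rcases le_total (f i) (f j) with h | h
  · by_contra! hlt
    exact absurd (hmax h hlt.le) (not_le.2 hlt)
  · exact h.trans hm

variable [MeasurableSpace X]

lemma summable_measureReal_singleton {Y : Type*} [MeasurableSpace Y] [MeasurableSingletonClass Y]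
    (μ : Measure Y) [IsFiniteMeasure μ] : Summable fun x => μ.real {x} := by
  refine ENNReal.summable_toReal (ne_top_of_le_ne_top (measure_ne_top μ Set.univ) ?_)
  exact (tsum_meas_le_meas_iUnion_of_disjoint μ (fun x => MeasurableSet.singleton x)
    (fun x y hxy => by simpa [Function.onFun] using hxy)).trans (measure_mono (Set.subset_univ _))

variable [Countable X] [MeasurableSingletonClass X]

/-- The structure of a centred pair of distributions with the symmetry property: on the subgroup
generated by the supports `1 - α` is invertible, and the weights of `μ` and `ν` form, up to
normalization, a reflection pair for `c = 1 - 2 (1 - α)⁻¹ = -(1 + α) (1 - α)⁻¹`. -/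
lemma HeydeSymmetric.eq_and_invariant (htors : IsAddTorsion X)
    (hcyc : ∀ p : ℕ, p.Prime → IsAddCyclic (AddCommGroup.primaryComponent X p))
    (h2 : ∀ x : X, addOrderOf x ≠ 2) {α : X ≃+ X} {μ ν : Measure X} [IsProbabilityMeasure μ]
    [IsProbabilityMeasure ν] (h : HeydeSymmetric α μ ν) (h0 : ν {0} ≠ 0) :
    μ = ν ∧ Finite ((AddSubgroup.closure {x | ν {x} ≠ 0}).map
        (AddMonoidHom.id X + α.toAddMonoidHom)) ∧
      ∀ t ∈ AddSubgroup.closure {x | ν {x} ≠ 0}, ∀ x, μ {x + (t + α t)} = μ {x} := by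
  obtain ⟨a, -, ha⟩ := exists_mem_singleton_ne_zero (m := μ) (S := Set.univ) (by simp)
  obtain ⟨hsub, hle, hsurj⟩ := closure_le_and_surjOn_of_reflection htors hcyc h2 α
    (A := {x | μ {x} ≠ 0}) (B := {x | ν {x} ≠ 0}) ⟨a, ha⟩ h0 (by
      intro x hx y hy
      obtain ⟨x', y', hx', hy', h1, h3⟩ := h.exists_reflection hx hy
      exact ⟨x', hx', y', hy', h1, h3⟩)
  set D := AddSubgroup.closure {x | ν {x} ≠ 0} with hD
  have hμD : ∀ x, x ∉ D → μ {x} = 0 := fun x hx => by_contra fun hne => hx (hsub hne)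
  have hνD : ∀ x, x ∉ D → ν {x} = 0 := fun x hx => by_contra fun hne =>
    hx (AddSubgroup.subset_closure hne)
  have hinj : ∀ z ∈ D, z - α z = 0 → z = 0 := fun z hz h' =>
    eq_zero_of_surjOn htors hcyc (AddMonoidHom.id X - α.toAddMonoidHom) hsurj hz h'
  -- `β` and `a'` are the restrictions of `1 - α` and `α` to `D`.
  let a' : D →+ D := (α.toAddMonoidHom.comp D.subtype).codRestrict D
    fun x => (apply_equiv_mem_iff htors hcyc α).2 x.2
  have ha' : ∀ x : D, (a' x : X) = α x := fun _ => rfl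
  have hβbij : Function.Bijective (AddMonoidHom.id D - a') := by
    refine ⟨(injective_iff_map_eq_zero _).2 fun x hx => ?_, fun x => ?_⟩
    · exact Subtype.ext (hinj x x.2 (congrArg Subtype.val hx))
    · obtain ⟨u, hu, hux⟩ := hsurj x x.2
      exact ⟨⟨u, hu⟩, Subtype.ext hux⟩
  let β : D ≃+ D := AddEquiv.ofBijective _ hβbij
  have hβ : ∀ x, β x = x - a' x := fun _ => rfl
  have hα : ∀ x, a' x = x - β x := fun x => by rw [hβ]; abel
  let c : D →+ D := AddMonoidHom.id D - 2 • β.symm.toAddMonoidHom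
  have hc : ∀ x, c x = x - 2 • β.symm x := fun _ => rfl
  have hcβ : ∀ x, c (-β x) = x + a' x := by
    intro x
    rw [hc, map_neg, β.symm_apply_apply, hα]
    abel
  have htwo : ∀ x : D, ∃ y : D, 2 • y = x := by
    intro x
    have : (x : X) ∈ D.map (nsmulAddMonoidHom 2) :=
      (two_nsmul_mem_iff htors hcyc h2).1 ⟨x, x.2, rfl⟩
    obtain ⟨y, hy, hyx⟩ := this
    exact ⟨⟨y, hy⟩, Subtype.ext hyx⟩
  have htwo0 : ∀ x : D, 2 • x = 0 → x = 0 := fun x hx =>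
    Subtype.ext (eq_zero_of_two_nsmul_eq_zero h2 (congrArg Subtype.val hx))
  have hbsub : Function.Bijective (AddMonoidHom.id D - c) := by
    have e : ∀ x, (AddMonoidHom.id D - c) x = 2 • β.symm x := fun x => by
      change x - c x = _
      rw [hc]; abel
    refine ⟨(injective_iff_map_eq_zero _).2 fun x hx => ?_, fun x => ?_⟩
    · rw [e] at hx
      simpa using htwo0 _ hx
    · obtain ⟨y, hy⟩ := htwo x
      exact ⟨β y, by rw [e, β.symm_apply_apply, hy]⟩
  have hbadd : Function.Bijective (AddMonoidHom.id D + c) := by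
    have e : ∀ x, (AddMonoidHom.id D + c) (-β x) = 2 • a' x := fun x => by
      change -β x + c (-β x) = _
      rw [hcβ, hα]; abel
    refine ⟨(injective_iff_map_eq_zero _).2 fun x hx => ?_, fun x => ?_⟩
    · obtain ⟨u, rfl⟩ : ∃ u, x = -β u := ⟨-β.symm x, by simp⟩
      rw [e] at hx
      have hu : u = 0 := by
        have : α (u : X) = 0 := congrArg Subtype.val (htwo0 _ hx)
        exact Subtype.ext (by simpa using this)
      rw [hu, map_zero, neg_zero]
    · obtain ⟨y, hy⟩ := htwo x
      have hmem : α.symm y ∈ D := (apply_equiv_mem_iff htors hcyc α.symm).2 y.2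
      refine ⟨-β ⟨α.symm y, hmem⟩, ?_⟩
      rw [e, ← hy]
      congr 1
      exact Subtype.ext (α.apply_symm_apply y)
  have hmul : ∀ x y : D, μ {(c x + (y + c y) : D).1} * ν {(x - c x - c y : D).1} =
      μ {x.1} * ν {y.1} := by
    intro x y
    refine h.mul_singleton_eq (fun y hy => AddSubgroup.subset_closure hy) hinj y.2
      (Subtype.mem _) ?_ ?_
    · have : c x + (y + c y) + (x - c x - c y) = x + y := by abel
      exact congrArg Subtype.val this
    · have : c x + (y + c y) + a' (x - c x - c y) = -(x + a' y) := by
        obtain ⟨u, rfl⟩ : ∃ u, x = -β u := ⟨-β.symm x, by simp⟩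
        obtain ⟨v, rfl⟩ : ∃ v, y = -β v := ⟨-β.symm y, by simp⟩
        rw [hcβ, hcβ]
        simp only [hα, map_sub, map_neg, map_add]
        abel
      exact congrArg Subtype.val this
  have hsμ : Summable fun x : D => μ.real {x.1} :=
    (summable_measureReal_singleton μ).comp_injective Subtype.val_injective
  have hsν : Summable fun x : D => ν.real {x.1} :=
    (summable_measureReal_singleton ν).comp_injective Subtype.val_injective
  have hposμ : 0 < μ.real {(⟨a, hsub ha⟩ : D).1} :=
    ENNReal.toReal_pos ha (measure_ne_top _ _)
  have hposν : 0 < ν.real {(0 : D).1} := ENNReal.toReal_pos h0 (measure_ne_top _ _)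
  obtain ⟨m, hm⟩ := exists_forall_le_of_summable hsμ hposμ
  obtain ⟨n, hn⟩ := exists_forall_le_of_summable hsν hposν
  have hm0 := hposμ.trans_le (hm _)
  have hn0 := hposν.trans_le (hn _)
  have hpair : IsReflectionPair c (fun x : D => μ.real {x.1} / μ.real {m.1})
      (fun x : D => ν.real {x.1} / ν.real {n.1}) :=
    { nonneg_left := fun x => by positivity
      nonneg_right := fun x => by positivity
      summable_left := hsμ.div_const _
      summable_right := hsν.div_const _
      le_one_left := fun x => (div_le_one hm0).2 (hm x)
      le_one_right := fun x => (div_le_one hn0).2 (hn x)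
      exists_eq_one_left := ⟨m, div_self hm0.ne'⟩
      exists_eq_one_right := ⟨n, div_self hn0.ne'⟩
      bijective_sub := hbsub
      bijective_add := hbadd
      invariant := fun x y => by
        rw [div_mul_div_comm, div_mul_div_comm]
        congr 1
        have := congrArg ENNReal.toReal (hmul x y)
        rwa [ENNReal.toReal_mul, ENNReal.toReal_mul] at this }
  have htorsD : IsAddTorsion D := htors.addSubgroup D
  have hgen : AddSubgroup.closure {z : D | ∃ x x' : D, μ.real {x.1} / μ.real {m.1} ≠ 0 ∧
      μ.real {x'.1} / μ.real {m.1} ≠ 0 ∧ z = x - x'} = ⊤ := by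
    have hne : ∀ x ∈ {x | μ {x} ≠ 0}, μ.real {x} / μ.real {m.1} ≠ 0 := fun x hx =>
      div_ne_zero (ENNReal.toReal_ne_zero.2 ⟨hx, measure_ne_top _ _⟩) hm0.ne'
    have hmap : D ≤ (AddSubgroup.closure {z : D | ∃ x x' : D, μ.real {x.1} / μ.real {m.1} ≠ 0 ∧
        μ.real {x'.1} / μ.real {m.1} ≠ 0 ∧ z = x - x'}).map D.subtype := by
      refine hle.trans ((AddSubgroup.closure_le _).2 ?_)
      rintro z ⟨x, hx, x', hx', rfl⟩
      exact ⟨⟨x, hsub hx⟩ - ⟨x', hsub hx'⟩, AddSubgroup.subset_closure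
        ⟨⟨x, hsub hx⟩, ⟨x', hsub hx'⟩, hne x hx, hne x' hx', rfl⟩, rfl⟩
    refine (AddSubgroup.eq_top_iff' _).2 fun x => ?_
    obtain ⟨y, hy, hyx⟩ := hmap x.2
    rwa [← Subtype.ext (a1 := y) (a2 := x) hyx]
  refine ⟨?_, ?_, ?_⟩
  · -- `μ` and `ν` are proportional, hence equal as both have total mass `1`.
    have heq := hpair.eq_right htorsD hgen
    have hprop : μ = ENNReal.ofReal (μ.real {m.1} / ν.real {n.1}) • ν := by
      refine Measure.ext_of_singleton fun x => ?_
      rw [Measure.smul_apply, smul_eq_mul]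
      by_cases hx : x ∈ D
      · have := congrFun heq ⟨x, hx⟩
        rw [← ENNReal.ofReal_toReal (measure_ne_top ν {x}),
          ← ENNReal.ofReal_mul (by positivity), ← ENNReal.ofReal_toReal (measure_ne_top μ {x})]
        congr 1
        change μ.real {x} = _ * ν.real {x}
        rw [div_eq_div_iff hm0.ne' hn0.ne'] at this
        field_simp
        linarith
      · rw [hμD x hx, hνD x hx, mul_zero]
    have hone : ENNReal.ofReal (μ.real {m.1} / ν.real {n.1}) = 1 := by
      have := congrArg (fun m : Measure X => m Set.univ) hprop
      simpa using this.symm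
    rwa [hone, one_smul] at hprop
  · have := hpair.finite_range htorsD hgen
    refine Set.Finite.subset ((Set.toFinite (c.range : Set D)).image Subtype.val) ?_
    rintro _ ⟨t, ht, rfl⟩
    exact ⟨_, ⟨-β ⟨t, ht⟩, rfl⟩, congrArg Subtype.val (hcβ ⟨t, ht⟩)⟩
  · intro t ht x
    have htD : t + α t ∈ D := D.add_mem ht ((apply_equiv_mem_iff htors hcyc α).2 ht)
    by_cases hx : x ∈ D
    · have := hpair.map_mem_periods htorsD hgen (-β ⟨t, ht⟩) ⟨x, hx⟩
      rw [hcβ] at this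
      have hreal := (div_left_inj' hm0.ne').1 this
      exact (ENNReal.toReal_eq_toReal_iff' (measure_ne_top _ _) (measure_ne_top _ _)).1 hreal
    · rw [hμD x hx, hμD _ fun hmem => hx ((D.add_mem_cancel_right htD).1 hmem)]

end Structure

/-! ### Haar factors of invariant distributions -/

section HaarFactor

lemma mem_support_iff_singleton {Y : Type*} [TopologicalSpace Y] [DiscreteTopology Y]
    [MeasurableSpace Y] {μ : Measure Y} {x : Y} : x ∈ μ.support ↔ μ {x} ≠ 0 := by
  rw [Measure.mem_support_iff_forall, ← pos_iff_ne_zero]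
  exact ⟨fun h => h _ (by simp), fun h U hU =>
    h.trans_le (measure_mono (Set.singleton_subset_iff.2 (mem_of_mem_nhds hU)))⟩

variable {X : Type*} [AddCommGroup X] [TopologicalSpace X] [DiscreteTopology X]
  [MeasurableSpace X] [BorelSpace X]

instance isProbabilityMeasure_haarDistribution (K : AddSubgroup X) [CompactSpace K] :
    IsProbabilityMeasure (haarDistribution K) := by
  have : IsProbabilityMeasure
      (Measure.addHaarMeasure (⊤ : TopologicalSpace.PositiveCompacts K)) :=
    ⟨Measure.addHaarMeasure_self (K₀ := (⊤ : TopologicalSpace.PositiveCompacts K))⟩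
  exact Measure.isProbabilityMeasure_map continuous_subtype_val.aemeasurable

/-- A distribution invariant under the translations from `K` is unchanged by convolution with the
Haar distribution of `K`. -/
lemma haarDistribution_conv_eq [Countable X] (K : AddSubgroup X) [CompactSpace K] {μ : Measure X}
    [IsProbabilityMeasure μ] (hinv : ∀ k ∈ K, ∀ x, μ {x + k} = μ {x}) :
    (haarDistribution K).conv μ = μ := by
  have hshift : ∀ k ∈ K, ∀ s : Set X, μ ((fun y => k + y) ⁻¹' s) = μ s := by
    intro k hk s
    rw [← Measure.map_apply .of_discrete .of_discrete]
    congr 1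
    refine Measure.ext_of_singleton fun x => ?_
    rw [Measure.map_apply .of_discrete .of_discrete, ← hinv _ (K.neg_mem hk)]
    congr 1
    ext y
    simp [eq_add_neg_iff_add_eq, add_comm]
  have hae : ∀ᵐ k ∂(haarDistribution K), k ∈ K := by
    refine (ae_map_iff continuous_subtype_val.aemeasurable .of_discrete).2 ?_
    exact Filter.Eventually.of_forall fun k => k.2
  ext s hs
  rw [Measure.conv, Measure.map_apply .of_discrete .of_discrete, Measure.prod_apply .of_discrete]
  calc ∫⁻ k, μ (Prod.mk k ⁻¹' ((fun p : X × X => p.1 + p.2) ⁻¹' s)) ∂(haarDistribution K)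
      = ∫⁻ _, μ s ∂(haarDistribution K) :=
        lintegral_congr_ae (hae.mono fun k hk => hshift k hk s)
    _ = μ s := by simp

end HaarFactor

/-! ### Heyde's theorem on torsion groups with cyclic components -/

theorem theorem2p1 {X : Type*} [AddCommGroup X] [TopologicalSpace X] [DiscreteTopology X]
    [MeasurableSpace X] [BorelSpace X]
    (htors : IsAddTorsion X)
    (hcyc : ∀ p : ℕ, p.Prime → IsAddCyclic (AddCommGroup.primaryComponent X p))
    (h2 : ∀ x : X, addOrderOf x ≠ 2)
    (α : X ≃+ X)
    {Ω : Type*} [MeasurableSpace Ω] (P : Measure Ω) [IsProbabilityMeasure P]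
    (ξ₁ ξ₂ : Ω → X) (μ₁ μ₂ : Measure X)
    (hξ₁ : HasLaw ξ₁ μ₁ P) (hξ₂ : HasLaw ξ₂ μ₂ P) (hindep : IndepFun ξ₁ ξ₂ P)
    (hsymm : CondDistribIsSymmetric (fun ω => ξ₁ ω + α (ξ₂ ω)) (fun ω => ξ₁ ω + ξ₂ ω) P) :
    ∃ (G : AddSubgroup X) (lam : Measure X),
      IsProbabilityMeasure lam ∧ lam (G : Set X)ᶜ = 0 ∧
      -- both distributions are shifts of `lam`
      (IsShiftOf μ₁ lam ∧ IsShiftOf μ₂ lam) ∧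
      -- `G` is the smallest subgroup containing the support of `lam`
      IsLeast {H : AddSubgroup X | lam.support ⊆ (H : Set X)} G ∧
      -- `(I + α)(G)` is finite, and its Haar distribution is a factor of `lam`
      (∃ _ : Finite (G.map (AddMonoidHom.id X + α.toAddMonoidHom)),
        IsFactorOf (haarDistribution (G.map (AddMonoidHom.id X + α.toAddMonoidHom))) lam) ∧
      -- independent copies with distribution `lam` again have the symmetry property
      (∀ {Ω' : Type*} [MeasurableSpace Ω'] (P' : Measure Ω') [IsProbabilityMeasure P']
        (η₁ η₂ : Ω' → X), HasLaw η₁ lam P' → HasLaw η₂ lam P' → IndepFun η₁ η₂ P' →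
        CondDistribIsSymmetric (fun ω => η₁ ω + α (η₂ ω)) (fun ω => η₁ ω + η₂ ω) P') := by
  have := countable_of_isAddTorsion_of_isAddCyclic htors hcyc
  have : IsProbabilityMeasure μ₁ := hξ₁.isProbabilityMeasure_iff.1 inferInstance
  have : IsProbabilityMeasure μ₂ := hξ₂.isProbabilityMeasure_iff.1 inferInstance
  have hS := (condDistribIsSymmetric_iff_heydeSymmetric α hξ₁ hξ₂ hindep).1 hsymm
  obtain ⟨z, -, hz⟩ := exists_mem_singleton_ne_zero (m := μ₂) (S := Set.univ) (by simp)
  -- Shifting `ξ₁` by `α z` and `ξ₂` by `-z` does not change `ξ₁ + α ξ₂`, and puts `0` in the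
  -- support of the second distribution.
  set lam := μ₁.map fun x => x + α z with hlam
  set nu := μ₂.map fun x => x - z with hnu
  have : IsProbabilityMeasure lam :=
    Measure.isProbabilityMeasure_map Measurable.of_discrete.aemeasurable
  have : IsProbabilityMeasure nu :=
    Measure.isProbabilityMeasure_map Measurable.of_discrete.aemeasurable
  have hshift : HeydeSymmetric α lam nu := hS.shift z
  have hnu0 : nu {0} ≠ 0 := by
    rw [hnu, Measure.map_apply .of_discrete .of_discrete]
    have : (fun x => x - z) ⁻¹' {0} = {z} := by ext x; simp [sub_eq_zero]
    rwa [this]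
  obtain ⟨heq, hfin, hinv⟩ := hshift.eq_and_invariant htors hcyc h2 hnu0
  rw [← heq] at hshift hfin hinv
  have hsupp : lam.support = {x | lam {x} ≠ 0} := Set.ext fun x => mem_support_iff_singleton
  refine ⟨AddSubgroup.closure {x | lam {x} ≠ 0}, lam, inferInstance, ?_, ⟨⟨-α z, ?_⟩, ⟨z, ?_⟩⟩,
    ⟨?_, ?_⟩, ⟨hfin, lam, inferInstance, ?_⟩, ?_⟩
  · by_contra h
    obtain ⟨x, hx, hx0⟩ := exists_mem_singleton_ne_zero h
    exact hx (AddSubgroup.subset_closure hx0)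
  · rw [Measure.dirac_conv, hlam, Measure.map_map .of_discrete .of_discrete]
    have : (fun y => -α z + y) ∘ (fun x => x + α z) = id := by ext x; simp
    rw [this, Measure.map_id]
  · rw [Measure.dirac_conv, heq, hnu, Measure.map_map .of_discrete .of_discrete]
    have : (fun y => z + y) ∘ (fun x => x - z) = id := by ext x; simp
    rw [this, Measure.map_id]
  · rw [Set.mem_ofPred_eq, hsupp]
    exact AddSubgroup.subset_closure
  · intro H hH
    rw [Set.mem_ofPred_eq, hsupp] at hH
    exact (AddSubgroup.closure_le H).2 hH
  · refine (haarDistribution_conv_eq _ ?_).symm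
    rintro _ ⟨t, ht, rfl⟩ x
    exact hinv t ht x
  · intro Ω' _ P' _ η₁ η₂ hη₁ hη₂ hη
    exact (condDistribIsSymmetric_iff_heydeSymmetric α hη₁ hη₂ hη).2 hshift
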